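/- An oriented matroid $\mathcal M=(E,\mathcal C)$ on a finite ground set $E$ is given by its set $\mathcal C\subseteq\{+,-,0\}^E$ of signed circuits (satisfying the oriented matroid circuit axioms); its rank is the size of a largest subset of $E$ containing no support of a circuit. For $X\in\mathcal C$ let $X^+$ and $X^-$ be its sets of positive and negative elements. For $k\ge 0$, $\mathcal M$ is $k$-neighborly if $|X^+|>k$ and $|X^-|>k$ for every circuit $X\in\mathcal C$. For $R\subseteq E$, the reorientation ${}_{-R}\mathcal M$ is obtained by reversing the sign of $X_e$ for all $e\in R$ and $X\in\mathcal C$; a $k$-neighborly reorientation of $\mathcal M$ is a subset $R\subseteq E$ such that ${}_{-R}\mathcal M$ is $k$-neighborly. Fix integers $k\ge 1$ and $r\ge 2k+2$. Then, as $n\to\infty$, every oriented matroid of rank $r$ on $n$ elements has at most $$2\binom{n}{r-1-2k}+O\!\left(n^{r-2-2k}\right)$$ $k$-neighborly reorientations, where the implied constant depends only on $r$ and $k$ (not on the oriented matroid). -/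

import Mathlib

/-- A sign vector on the ground set `E`, i.e. an element of `{+, -, 0}^E`. -/
abbrev SignVector (E : Type*) := E → SignType

namespace SignVector

variable {E : Type*} [Fintype E]

/-- The set `X⁺` of positive elements. -/
def pos (X : SignVector E) : Finset E := {e | X e = 1}

/-- The set `X⁻` of negative elements. -/
def neg (X : SignVector E) : Finset E := {e | X e = -1}

/-- The support of `X`, the set of elements with non-zero sign. -/
def support (X : SignVector E) : Finset E := {e | X e ≠ 0}

/-- The sign vector obtained from `X` by reversing the signs of the elements of `R`. -/
def reorient {E : Type*} [DecidableEq E] (R : Finset E) (X : SignVector E) : SignVector E :=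
  fun e => if e ∈ R then -X e else X e

end SignVector

/-- An oriented matroid on the finite ground set `E`, given by its signed circuits. -/
structure OrientedMatroid (E : Type*) [Fintype E] [DecidableEq E] where
  /-- The set of signed circuits. -/
  circuits : Set (SignVector E)
  zero_notMem : (0 : SignVector E) ∉ circuits
  neg_mem : ∀ X ∈ circuits, -X ∈ circuits
  eq_or_eq_neg : ∀ X ∈ circuits, ∀ Y ∈ circuits,
    X.support ⊆ Y.support → X = Y ∨ X = -Y
  elimination : ∀ X ∈ circuits, ∀ Y ∈ circuits, X ≠ -Y → ∀ e ∈ X.pos ∩ Y.neg,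
    ∃ Z ∈ circuits, Z.pos ⊆ (X.pos ∪ Y.pos).erase e ∧ Z.neg ⊆ (X.neg ∪ Y.neg).erase e

namespace SignVector

theorem reorient_reorient {E : Type*} [DecidableEq E] (R : Finset E) (X : SignVector E) :
    reorient R (reorient R X) = X := by
  funext e
  by_cases h : e ∈ R <;> simp [reorient, h]

theorem reorient_neg {E : Type*} [DecidableEq E] (R : Finset E) (X : SignVector E) :
    reorient R (-X) = -reorient R X := by
  funext e
  by_cases h : e ∈ R <;> simp [reorient, h]

variable {E : Type*} [Fintype E]

theorem mem_pos {X : SignVector E} {e : E} : e ∈ X.pos ↔ X e = 1 := by simp [pos]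

theorem mem_neg {X : SignVector E} {e : E} : e ∈ X.neg ↔ X e = -1 := by simp [neg]

theorem mem_support {X : SignVector E} {e : E} : e ∈ X.support ↔ X e ≠ 0 := by simp [support]

variable [DecidableEq E]

theorem support_reorient (R : Finset E) (X : SignVector E) :
    (reorient R X).support = X.support := by
  ext e
  rw [mem_support, mem_support, reorient]
  by_cases h : e ∈ R <;> cases hX : X e <;> simp [h]

theorem mem_pos_reorient (R : Finset E) (X : SignVector E) (e : E) :
    e ∈ (reorient R X).pos ↔ if e ∈ R then e ∈ X.neg else e ∈ X.pos := by
  simp only [mem_pos, mem_neg, reorient]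
  by_cases h : e ∈ R <;> cases hX : X e <;> simp [h]

theorem mem_neg_reorient (R : Finset E) (X : SignVector E) (e : E) :
    e ∈ (reorient R X).neg ↔ if e ∈ R then e ∈ X.pos else e ∈ X.neg := by
  simp only [mem_pos, mem_neg, reorient]
  by_cases h : e ∈ R <;> cases hX : X e <;> simp [h]

end SignVector

namespace OrientedMatroid

variable {E : Type*} [Fintype E] [DecidableEq E]

/-- A set is independent if it does not contain (the support of) a circuit. -/
def Indep (M : OrientedMatroid E) (I : Finset E) : Prop :=
  ∀ X ∈ M.circuits, ¬ X.support ⊆ I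

open Classical in
/-- The rank: the size of a largest set that does not contain a circuit. -/
noncomputable def rank (M : OrientedMatroid E) : ℕ :=
  (Finset.univ.filter fun I : Finset E => M.Indep I).sup Finset.card

/-- The reorientation of `M` along `R`: the signs of the elements of `R` are reversed in every
circuit. -/
def reorient (M : OrientedMatroid E) (R : Finset E) : OrientedMatroid E where
  circuits := SignVector.reorient R '' M.circuits
  zero_notMem := by
    rintro ⟨X, hX, h⟩
    have h0 : X = 0 := by
      rw [← SignVector.reorient_reorient R X, h]
      funext e
      simp [SignVector.reorient]
    exact M.zero_notMem (h0 ▸ hX)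
  neg_mem := by
    rintro _ ⟨X, hX, rfl⟩
    exact ⟨-X, M.neg_mem X hX, SignVector.reorient_neg R X⟩
  eq_or_eq_neg := by
    rintro _ ⟨X, hX, rfl⟩ _ ⟨Y, hY, rfl⟩ h
    rw [SignVector.support_reorient, SignVector.support_reorient] at h
    rcases M.eq_or_eq_neg X hX Y hY h with h | h
    · exact Or.inl (by rw [h])
    · exact Or.inr (by rw [h, SignVector.reorient_neg])
  elimination := by
    rintro _ ⟨X, hX, rfl⟩ _ ⟨Y, hY, rfl⟩ hne e he
    have hXY : X ≠ -Y := fun h => hne (by rw [h, SignVector.reorient_neg])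
    have key : ∃ Z ∈ M.circuits, Z.pos ⊆ (X.pos ∪ Y.pos).erase e ∧
        Z.neg ⊆ (X.neg ∪ Y.neg).erase e := by
      rw [Finset.mem_inter, SignVector.mem_pos_reorient, SignVector.mem_neg_reorient] at he
      by_cases heR : e ∈ R
      · simp only [heR, if_true] at he
        have hYX : Y ≠ -X := fun h => hXY (by rw [h, neg_neg])
        obtain ⟨Z, hZ, h1, h2⟩ := M.elimination Y hY X hX hYX e
          (Finset.mem_inter.2 ⟨he.2, he.1⟩)
        exact ⟨Z, hZ, by rwa [Finset.union_comm], by rwa [Finset.union_comm]⟩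
      · simp only [heR, if_false] at he
        exact M.elimination X hX Y hY hXY e (Finset.mem_inter.2 he)
    obtain ⟨Z, hZ, h1, h2⟩ := key
    refine ⟨_, ⟨Z, hZ, rfl⟩, ?_, ?_⟩
    · intro f hf
      have h1 := @h1 f
      have h2 := @h2 f
      simp only [Finset.mem_erase, Finset.mem_union, SignVector.mem_pos_reorient] at *
      split_ifs at * <;> tauto
    · intro f hf
      have h1 := @h1 f
      have h2 := @h2 f
      simp only [Finset.mem_erase, Finset.mem_union, SignVector.mem_neg_reorient] at *
      split_ifs at * <;> tauto

/-- `M` is `k`-neighborly if every circuit has more than `k` positive and more than `k` negative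
elements. -/
def IsNeighborly (M : OrientedMatroid E) (k : ℕ) : Prop :=
  ∀ X ∈ M.circuits, k < X.pos.card ∧ k < X.neg.card

open Classical in
/-- The number of `k`-neighborly reorientations of `M`, i.e. of subsets `R` of the ground set such
that the reorientation of `M` along `R` is `k`-neighborly. -/
noncomputable def numNeighborlyReorientations (M : OrientedMatroid E) (k : ℕ) : ℕ :=
  (Finset.univ.filter fun R : Finset E => (M.reorient R).IsNeighborly k).card

end OrientedMatroid

/-! The count obeys a Pascal-type recurrence. For `e ∉ S`, split the neighborly sets on `insert e S`
by whether they contain `e`. A trace on `S` arising either way is neighborly for the deletion of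
`e`, and a trace arising both ways is neighborly for the contraction
(`card_neighborlySets_insert_le`).

`CoversSubsets C S m` stands in for "rank less than `m`": deletion keeps `m`, contraction lowers it
by one. Restrictions to `S` need not be circuits, so the induction runs over arbitrary families of
sign vectors. At `m = 2 * k + 2` a parity argument leaves at most two sets once `S` has `2 * k + 3`
elements. Each further unit of `m` sums the bound over `n`, turning `2` into `2 * n.choose j` plus
lower-order terms. -/

namespace SignVector

variable {α : Type*} [DecidableEq α]

/-- The sets `R ⊆ S` such that, after reorienting along `R`, every member of the family `C`
restricted to `S` has more than `k` positive and more than `k` negative elements. -/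
noncomputable def neighborlySets (C : Set (SignVector α)) (S : Finset α) (k : ℕ) :
    Finset (Finset α) :=
  open Classical in
  S.powerset.filter fun R => ∀ X ∈ C,
    k < (S.filter fun e => reorient R X e = 1).card ∧
    k < (S.filter fun e => reorient R X e = -1).card

theorem mem_neighborlySets {C : Set (SignVector α)} {S : Finset α} {k : ℕ} {R : Finset α} :
    R ∈ neighborlySets C S k ↔ R ⊆ S ∧ ∀ X ∈ C,
      k < (S.filter fun e => reorient R X e = 1).card ∧
      k < (S.filter fun e => reorient R X e = -1).card := by
  simp [neighborlySets]

theorem card_neighborlySets_le_two_pow (C : Set (SignVector α)) (S : Finset α) (k : ℕ) :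
    (neighborlySets C S k).card ≤ 2 ^ S.card := by
  classical
  rw [← Finset.card_powerset]
  exact Finset.card_le_card (Finset.filter_subset _ _)

/-- Every `m`-subset of `S` contains the support of the restriction to `S` of a member of `C`. -/
def CoversSubsets (C : Set (SignVector α)) (S : Finset α) (m : ℕ) : Prop :=
  ∀ T ⊆ S, T.card = m → ∃ X ∈ C, ∀ f ∈ S, X f ≠ 0 → f ∈ T

/-! ### Deletion and contraction -/

theorem CoversSubsets.delete {C : Set (SignVector α)} {S : Finset α} {m : ℕ} {e : α}
    (he : e ∉ S) (h : CoversSubsets C (insert e S) m) :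
    CoversSubsets {X ∈ C | X e = 0} S m := by
  intro T hT hm
  obtain ⟨X, hX, hXT⟩ := h T (hT.trans (Finset.subset_insert _ _)) hm
  refine ⟨X, ⟨hX, ?_⟩, fun f hf => hXT f (Finset.mem_insert_of_mem hf)⟩
  by_contra h0
  exact he (hT (hXT e (Finset.mem_insert_self _ _) h0))

theorem CoversSubsets.contract {C : Set (SignVector α)} {S : Finset α} {m : ℕ} {e : α}
    (he : e ∉ S) (h : CoversSubsets C (insert e S) (m + 1)) :
    CoversSubsets C S m := by
  intro T hT hm
  obtain ⟨X, hX, hXT⟩ := h (insert e T) (Finset.insert_subset_insert _ hT)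
    (by rw [Finset.card_insert_of_notMem (fun h => he (hT h)), hm])
  refine ⟨X, hX, fun f hf h0 => ?_⟩
  refine Finset.mem_of_mem_insert_of_ne (hXT f (Finset.mem_insert_of_mem hf) h0) ?_
  rintro rfl
  exact he hf

theorem filter_reorient_insert {S R : Finset α} {e : α} (he : e ∉ S) (X : SignVector α)
    (s : SignType) :
    (S.filter fun f => reorient (insert e R) X f = s) =
      S.filter fun f => reorient R X f = s := by
  refine Finset.filter_congr fun f hf => ?_
  have hne : f ≠ e := fun h => he (h ▸ hf)
  simp [reorient, hne]

/-- Deletion and contraction of an element. -/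
theorem card_neighborlySets_insert_le (C : Set (SignVector α)) {S : Finset α} (k : ℕ) {e : α}
    (he : e ∉ S) :
    (neighborlySets C (insert e S) k).card ≤
      (neighborlySets {X ∈ C | X e = 0} S k).card + (neighborlySets C S k).card := by
  set A := neighborlySets C (insert e S) k
  rw [← Finset.card_memberSubfamily_add_card_nonMemberSubfamily e A,
    ← Finset.card_union_add_card_inter]
  refine add_le_add (Finset.card_le_card ?_) (Finset.card_le_card ?_)
  · intro R hR
    rw [Finset.mem_union, Finset.mem_memberSubfamily, Finset.mem_nonMemberSubfamily] at hR
    have hsub : ∀ s : SignType, s ≠ 0 → ∀ Q : Finset α, ∀ X : SignVector α, X e = 0 →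
        ((insert e S).filter fun f => reorient Q X f = s) =
          S.filter fun f => reorient Q X f = s := by
      intro s hs Q X hX
      rw [Finset.filter_insert, if_neg]
      simpa [reorient, hX] using hs.symm
    rw [mem_neighborlySets]
    rcases hR with ⟨hR, heR⟩ | ⟨hR, heR⟩
    · obtain ⟨h1, h2⟩ := mem_neighborlySets.1 hR
      refine ⟨(Finset.insert_subset_insert_iff heR).1 h1, fun X hX => ?_⟩
      have := h2 X hX.1
      rwa [hsub _ (by decide) _ X hX.2, hsub _ (by decide) _ X hX.2,
        filter_reorient_insert he, filter_reorient_insert he] at this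
    · obtain ⟨h1, h2⟩ := mem_neighborlySets.1 hR
      refine ⟨(Finset.subset_insert_iff_of_notMem heR).1 h1, fun X hX => ?_⟩
      have := h2 X hX.1
      rwa [hsub _ (by decide) _ X hX.2, hsub _ (by decide) _ X hX.2] at this
  · intro R hR
    rw [Finset.mem_inter, Finset.mem_memberSubfamily, Finset.mem_nonMemberSubfamily] at hR
    obtain ⟨⟨hR1, heR⟩, hR2, -⟩ := hR
    obtain ⟨h1, h2⟩ := mem_neighborlySets.1 hR1
    obtain ⟨-, h3⟩ := mem_neighborlySets.1 hR2
    refine mem_neighborlySets.2 ⟨(Finset.insert_subset_insert_iff heR).1 h1, fun X hX => ?_⟩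
    have key : ∀ s : SignType, s ≠ 0 →
        k < ((insert e S).filter fun f => reorient (insert e R) X f = s).card →
        k < ((insert e S).filter fun f => reorient R X f = s).card →
        k < (S.filter fun f => reorient R X f = s).card := by
      intro s hs ha hb
      -- Exactly one of `R` and `insert e R` gives `e` the sign `X e`. If `X e = s`, then `insert e
      -- R` flips it away from `s`; otherwise `R` leaves it different from `s`. One of the two
      -- counts therefore omits `e`.
      by_cases hc : X e = s
      · rwa [Finset.filter_insert, if_neg, filter_reorient_insert he] at ha
        simp only [reorient, Finset.mem_insert_self, if_true, hc]
        revert hs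
        cases s <;> decide
      · rwa [Finset.filter_insert, if_neg] at hb
        simpa [reorient, heR] using hc
    exact ⟨key 1 (by decide) (h2 X hX).1 (h3 X hX).1,
      key (-1) (by decide) (h2 X hX).2 (h3 X hX).2⟩

/-! ### The base case: rank at most `2 * k + 1` -/

/-- A vector whose restriction to `S` is supported in `T` must, after either reorientation, have
exactly `k + 1` elements of each sign there, so it is nonzero on all of `T`. The two positive parts
have equal size and differ exactly on `T ∩ symmDiff R R'`. -/
theorem even_card_inter_symmDiff {C : Set (SignVector α)} {S : Finset α} {k : ℕ}
    (h : CoversSubsets C S (2 * k + 2)) {R R' : Finset α} (hR : R ∈ neighborlySets C S k)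
    (hR' : R' ∈ neighborlySets C S k) {T : Finset α} (hTS : T ⊆ S) (hT : T.card = 2 * k + 2) :
    Even (T ∩ symmDiff R R').card := by
  obtain ⟨X, hX, hXT⟩ := h T hTS hT
  have aux : ∀ Q ∈ neighborlySets C S k,
      (T.filter fun e => reorient Q X e = 1).card = k + 1 ∧ ∀ e ∈ T, X e ≠ 0 := by
    intro Q hQ
    obtain ⟨hp, hn⟩ := (mem_neighborlySets.1 hQ).2 X hX
    have hST : ∀ s : SignType, s ≠ 0 → (S.filter fun e => reorient Q X e = s) =
        T.filter fun e => reorient Q X e = s := by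
      intro s hs
      ext e
      simp only [Finset.mem_filter]
      refine ⟨fun ⟨ha, hb⟩ => ⟨hXT e ha fun h0 => hs ?_, hb⟩, fun ⟨ha, hb⟩ => ⟨hTS ha, hb⟩⟩
      rw [← hb]
      simp [reorient, h0]
    rw [hST _ (by decide)] at hp hn
    have hdisj : Disjoint (T.filter fun e => reorient Q X e = 1)
        (T.filter fun e => reorient Q X e = -1) := by
      refine Finset.disjoint_filter.2 fun e _ h1 h2 => ?_
      rw [h1] at h2
      exact absurd h2 (by decide)
    have hsub := Finset.union_subset (Finset.filter_subset (fun e => reorient Q X e = 1) T)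
      (Finset.filter_subset (fun e => reorient Q X e = -1) T)
    have hcard := Finset.card_union_of_disjoint hdisj
    have hle := Finset.card_le_card hsub
    refine ⟨by omega, fun e he h0 => ?_⟩
    have heq := Finset.eq_of_subset_of_card_le hsub (by omega)
    rw [← heq] at he
    simp only [Finset.mem_union, Finset.mem_filter] at he
    simp [reorient, h0] at he
  obtain ⟨h1, h0⟩ := aux R hR
  obtain ⟨h2, -⟩ := aux R' hR'
  set P := T.filter fun e => reorient R X e = 1
  set Q := T.filter fun e => reorient R' X e = 1
  have hPQ : T ∩ symmDiff R R' = (P \ Q) ∪ (Q \ P) := by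
    ext e
    simp only [P, Q, Finset.mem_inter, Finset.mem_symmDiff, Finset.mem_union, Finset.mem_sdiff,
      Finset.mem_filter]
    simp only [reorient]
    by_cases heT : e ∈ T
    · have := h0 e heT
      by_cases ha : e ∈ R <;> by_cases hb : e ∈ R' <;> cases hXe : X e <;> simp_all
    · simp [heT]
  have hd : Disjoint (P \ Q) (Q \ P) :=
    Finset.disjoint_left.2 fun e he he' =>
      (Finset.mem_sdiff.1 he).2 (Finset.mem_sdiff.1 he').1
  rw [hPQ, Finset.card_union_of_disjoint hd]
  have e1 := Finset.card_sdiff_add_card_inter P Q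
  have e2 := Finset.card_sdiff_add_card_inter Q P
  rw [Finset.inter_comm] at e2
  exact ⟨(P \ Q).card, by omega⟩

/-- If `symmDiff R R'` contains `e` but misses `f ∈ S`, then adding `e` or `f` to a common set of
size `2 * k + 1` gives intersections with it of opposite parity. So `R'` is `R` or its complement;
the bound on `S.card` makes room for the common set. -/
theorem card_neighborlySets_le_two {C : Set (SignVector α)} {S : Finset α} {k : ℕ}
    (h : CoversSubsets C S (2 * k + 2)) (hS : 2 * k + 3 ≤ S.card) :
    (neighborlySets C S k).card ≤ 2 := by
  rcases (neighborlySets C S k).eq_empty_or_nonempty with h0 | ⟨R, hR⟩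
  · simp [h0]
  refine (Finset.card_le_card (t := {R, S \ R}) fun R' hR' => ?_).trans Finset.card_le_two
  have hRS := (mem_neighborlySets.1 hR).1
  have hRS' := (mem_neighborlySets.1 hR').1
  rw [Finset.mem_insert, Finset.mem_singleton]
  by_contra! hne
  have h1 : ∃ e, e ∈ symmDiff R R' := by
    by_contra! hall
    exact hne.1 (symmDiff_eq_bot.1 (Finset.eq_empty_of_forall_notMem hall)).symm
  have h2 : ∃ f ∈ S, f ∉ symmDiff R R' := by
    by_contra! hall
    refine hne.2 (Finset.ext fun f => ?_)
    have h3 := @hall f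
    have h4 := @hRS' f
    rw [Finset.mem_symmDiff] at h3
    rw [Finset.mem_sdiff]
    tauto
  obtain ⟨e, he⟩ := h1
  obtain ⟨f, hfS, hf⟩ := h2
  have heS : e ∈ S := by
    rcases Finset.mem_symmDiff.1 he with h | h
    exacts [hRS h.1, hRS' h.1]
  have hef : e ≠ f := fun h => hf (h ▸ he)
  have hcard : ((S.erase e).erase f).card = S.card - 1 - 1 := by
    rw [Finset.card_erase_of_mem (Finset.mem_erase.2 ⟨hef.symm, hfS⟩),
      Finset.card_erase_of_mem heS]
  obtain ⟨T, hT, hTc⟩ := Finset.exists_subset_card_eq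
    (s := (S.erase e).erase f) (n := 2 * k + 1) (by omega)
  have hTS : T ⊆ S := hT.trans ((Finset.erase_subset _ _).trans (Finset.erase_subset _ _))
  have heT : e ∉ T := fun h => by simpa using hT h
  have hfT : f ∉ T := fun h => by simpa using hT h
  have ha := even_card_inter_symmDiff h hR hR' (T := insert e T)
    (Finset.insert_subset heS hTS) (by rw [Finset.card_insert_of_notMem heT, hTc])
  have hb := even_card_inter_symmDiff h hR hR' (T := insert f T)
    (Finset.insert_subset hfS hTS) (by rw [Finset.card_insert_of_notMem hfT, hTc])
  rw [Finset.insert_inter_of_mem he, Finset.card_insert_of_notMem (by simp [heT])] at ha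
  rw [Finset.insert_inter_of_notMem hf] at hb
  exact (Nat.even_add_one.1 ha) hb

/-! ### Solving the recurrence -/

theorem sum_range_choose_succ (n j : ℕ) :
    ∑ i ∈ Finset.range (j + 1), (n + 1).choose i =
      ∑ i ∈ Finset.range (j + 1), n.choose i + ∑ i ∈ Finset.range j, n.choose i := by
  rw [Finset.sum_range_succ', Finset.sum_range_succ' (fun i => n.choose i)]
  simp only [Nat.choose_succ_succ, Finset.sum_add_distrib, Nat.choose_zero_right, Nat.succ_eq_add_one]
  ring

/-- Both summands of the bound satisfy Pascal's recurrence exactly, so the induction on `n` loses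
nothing. The constant `2 ^ (2 * k + 3)` is the trivial count at the starting size. -/
theorem card_neighborlySets_le_of_le_card {k n : ℕ} (hn : 2 * k + 3 ≤ n) :
    ∀ (j : ℕ) (C : Set (SignVector α)) (S : Finset α), S.card = n →
      CoversSubsets C S (2 * k + 2 + j) →
      (neighborlySets C S k).card ≤
        2 * n.choose j + 2 ^ (2 * k + 3) * ∑ i ∈ Finset.range j, n.choose i := by
  induction n, hn using Nat.le_induction with
  | base =>
    rintro (_ | j) C S hS h
    · simpa using card_neighborlySets_le_two h hS.ge
    · have h1 := card_neighborlySets_le_two_pow C S k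
      rw [hS] at h1
      -- The term `i = 0` alone absorbs the trivial bound.
      rw [Finset.sum_range_succ', Nat.choose_zero_right]
      nlinarith [Nat.zero_le (2 ^ (2 * k + 3) *
        ∑ i ∈ Finset.range j, (2 * k + 3).choose (i + 1)),
        Nat.zero_le ((2 * k + 3).choose (j + 1))]
  | succ n hn ih =>
    rintro (_ | j) C S hS h
    · simpa using card_neighborlySets_le_two h (by omega)
    · obtain ⟨e, S, he, rfl, hS'⟩ := Finset.card_eq_succ.1 hS
      have h1 := ih (j + 1) _ S hS' (h.delete he)
      have h2 := ih j C S hS' (CoversSubsets.contract he h)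
      have h3 := card_neighborlySets_insert_le C k he
      rw [sum_range_choose_succ, Nat.choose_succ_succ]
      linarith

/-- Taking `j + 1` keeps the error sum nonempty, so its term `i = 0` also covers ground sets smaller
than `2 * k + 3`. -/
theorem card_neighborlySets_le {k j : ℕ} {C : Set (SignVector α)} {S : Finset α}
    (h : CoversSubsets C S (2 * k + 2 + (j + 1))) :
    (neighborlySets C S k).card ≤ 2 * S.card.choose (j + 1) +
      2 ^ (2 * k + 3) * ∑ i ∈ Finset.range (j + 1), S.card.choose i := by
  rcases le_total (2 * k + 3) S.card with hS | hS
  · exact card_neighborlySets_le_of_le_card hS _ C S rfl h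
  · have h1 := (card_neighborlySets_le_two_pow C S k).trans
      (Nat.pow_le_pow_right two_pos hS)
    rw [Finset.sum_range_succ', Nat.choose_zero_right]
    nlinarith [Nat.zero_le (2 ^ (2 * k + 3) *
      ∑ i ∈ Finset.range j, S.card.choose (i + 1)),
      Nat.zero_le (S.card.choose (j + 1))]

end SignVector

/-! ### Application to oriented matroids -/

namespace OrientedMatroid

variable {E : Type*} [Fintype E] [DecidableEq E]

theorem coversSubsets_of_rank_lt (M : OrientedMatroid E) {m : ℕ} (hm : M.rank < m) :
    SignVector.CoversSubsets M.circuits Finset.univ m := by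
  classical
  intro T _ hT
  have hdep : ¬ M.Indep T := by
    intro hI
    have : T.card ≤ M.rank := Finset.le_sup (f := Finset.card)
      (Finset.mem_filter.2 ⟨Finset.mem_univ T, hI⟩)
    omega
  simp only [Indep, not_forall, not_not] at hdep
  obtain ⟨X, hX, hXT⟩ := hdep
  exact ⟨X, hX, fun f _ hf => hXT (SignVector.mem_support.2 hf)⟩

theorem numNeighborlyReorientations_eq (M : OrientedMatroid E) (k : ℕ) :
    M.numNeighborlyReorientations k =
      (SignVector.neighborlySets M.circuits Finset.univ k).card := by
  classical
  unfold numNeighborlyReorientations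
  congr 1
  ext R
  simp [SignVector.mem_neighborlySets, IsNeighborly, reorient, SignVector.pos, SignVector.neg]

end OrientedMatroid

theorem isBigO_sum_range_choose (c : ℝ) (j : ℕ) :
    (fun n : ℕ => c * ∑ i ∈ Finset.range (j + 1), (n.choose i : ℝ)) =O[Filter.atTop]
      fun n : ℕ => (n : ℝ) ^ j := by
  refine Asymptotics.IsBigO.const_mul_left (Asymptotics.IsBigO.fun_sum fun i hi => ?_) c
  refine Asymptotics.IsBigO.of_bound 1 ?_
  filter_upwards [Filter.eventually_ge_atTop 1] with n hn
  rw [one_mul, Real.norm_of_nonneg (by positivity), Real.norm_of_nonneg (by positivity)]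
  have h1 : n.choose i ≤ n ^ j := (Nat.choose_le_pow n i).trans
    (Nat.pow_le_pow_right hn (Nat.lt_succ_iff.1 (Finset.mem_range.1 hi)))
  exact_mod_cast h1

theorem mainTheorem3 (k r : ℕ) (hk : 1 ≤ k) (hr : 2 * k + 2 ≤ r) :
    ∃ g : ℕ → ℝ,
      Asymptotics.IsBigO Filter.atTop g (fun n : ℕ => (n : ℝ) ^ (r - 2 - 2 * k)) ∧
      ∀ (n : ℕ) (E : Type*) [Fintype E] [DecidableEq E] (M : OrientedMatroid E),
        Fintype.card E = n → M.rank = r →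
        (M.numNeighborlyReorientations k : ℝ) ≤
          2 * (n.choose (r - 1 - 2 * k) : ℝ) + g n := by
  obtain ⟨j, rfl⟩ := Nat.exists_eq_add_of_le hr
  have e1 : 2 * k + 2 + j - 2 - 2 * k = j := by omega
  have e2 : 2 * k + 2 + j - 1 - 2 * k = j + 1 := by omega
  rw [e1, e2]
  refine ⟨_, isBigO_sum_range_choose (2 ^ (2 * k + 3)) j, ?_⟩
  intro n E _ _ M hn hM
  -- With rank `2 * k + 2 + j`, every set of one more element is dependent, which is the covering
  -- hypothesis at `j + 1`.
  have h := SignVector.card_neighborlySets_le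
    (M.coversSubsets_of_rank_lt (m := 2 * k + 2 + (j + 1)) (by omega))
  rw [← M.numNeighborlyReorientations_eq, Finset.card_univ, hn] at h
  exact_mod_cast h
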